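/- Let $u$ be a complex number such that $\mathbb{Z}[u]$ is the integral closure of $\mathbb{Z}$ in $\mathbb{Q}[u]$, and such that the unit group $\mathbb{Z}[u]^*$ is infinite and generated by $u$ and $-1$ (in particular, $u$ is a unit of $\mathbb{Z}[u]$). Then there exists a sentence $\psi$ in the first-order language of groups such that, for every group $G$, the following are equivalent: 1. $G$ is finitely generated and satisfies $\psi$; 2. $G$ is isomorphic to a semidirect product $A \rtimes \langle u \rangle$ for some non-zero ideal $A$ of $\mathbb{Z}[u]$, where $A$ is regarded as an additive group, $\langle u\rangle$ is the subgroup of $\mathbb{Z}[u]^*$ generated by $u$, and $u$ acts on $A$ by multiplication, $x \mapsto xu$. -/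

import Mathlib

/-- Function symbols of the first-order language of groups: multiplication, inverse, identity. -/
inductive GroupFunc : ℕ → Type
  | mul : GroupFunc 2
  | inv : GroupFunc 1
  | one : GroupFunc 0

/-- The first-order language of groups; equality is the only relation. -/
def groupLanguage : FirstOrder.Language where
  Functions := GroupFunc
  Relations := fun _ => Empty

/-- Every group is a structure for the language of groups, each symbol having its usual meaning. -/
instance groupStructure (G : Type*) [Group G] : groupLanguage.Structure G where
  funMap := fun {_} f =>
    match f with
    | GroupFunc.mul => fun x => x 0 * x 1
    | GroupFunc.inv => fun x => (x 0)⁻¹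
    | GroupFunc.one => fun _ => 1
  RelMap := fun r => nomatch r

/-- The subring `ℤ[u]` of `ℂ`. -/
abbrev IntAdjoin (u : ℂ) : Subalgebra ℤ ℂ := Algebra.adjoin ℤ {u}

/-- The subring `ℚ[u]` of `ℂ`. -/
noncomputable abbrev RatAdjoin (u : ℂ) : Subalgebra ℚ ℂ := Algebra.adjoin ℚ {u}

/-- For an ideal `A` of a commutative ring `R` and a subgroup `H` of `Rˣ`, the action of `H` on
the additive group of `A` by multiplication, `x ↦ h * x`. The additive group of `A` is written
multiplicatively, as `Multiplicative A`. -/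
def idealMulAction {R : Type*} [CommRing R] (A : Ideal R) (H : Subgroup Rˣ) :
    H →* MulAut (Multiplicative A) where
  toFun h := AddEquiv.toMultiplicative (DistribMulAction.toAddEquiv A (h : Rˣ))
  map_one' := MulEquiv.ext fun x => congrArg Multiplicative.ofAdd (one_smul Rˣ x.toAdd)
  map_mul' h k := MulEquiv.ext fun x =>
    congrArg Multiplicative.ofAdd (mul_smul (h : Rˣ) (k : Rˣ) x.toAdd)

/-- The semidirect product `A ⋊ ⟨v⟩` of the additive group of an ideal `A` of `R` by the cyclic
group generated by a unit `v` of `R`, where `v` acts on `A` by multiplication. -/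
abbrev IdealSemidirect {R : Type*} [CommRing R] (A : Ideal R) (v : Rˣ) : Type _ :=
  Multiplicative A ⋊[idealMulAction A (Subgroup.zpowers v)] Subgroup.zpowers v

/-! Write R = ℤ[u], of rank n over ℤ. In A ⋊ ⟨u⟩ the factors are centralizers: A of any of its
non-zero elements `a`, and ⟨u⟩ of its generator `t`. The sentence says that some `a`, `t` satisfy
`SplitAxioms`: G is the product of a normal abelian A = C(a) and an abelian C = C(t) meeting
trivially; the minimal polynomial of u kills conjugation by `t` on A; centralizers of non-trivial
elements of A lie in A; A has no 2-torsion and `a` is not a square; the squares have at most 2^n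
cosets in A; and C = C² ∪ tC². Semidirect products satisfy this by `IsSplit.splitAxioms`.

Conversely, let G be finitely generated with these properties. Then A is an R-module on which u acts
as `t`. The group C/⟨t⟩ is finitely generated abelian with all elements squares, hence finite, so A
is finitely generated over R. Elements of C other than 1 fix no non-zero element of A, and every
non-zero r in R divides some u^m - 1; as `t` has infinite order, A is torsion-free. Its rank is at
most n, so A embeds in R as a non-zero ideal. Some positive power of each c in C lies in ⟨t⟩, so c
acts as a fraction with a power in Rˣ. Since R is integrally closed, c acts as a unit ±u^j, so c² =
t^(2j). Thus C² ⊆ ⟨t⟩ and C = ⟨t⟩. This is `zpowers_eq_top_and_exists_injective`, applied to G in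
`exists_isSplit_of_splitAxioms`. -/

open FirstOrder FirstOrder.Language Polynomial

-- Word maps and first-order definability

universe w

/-- A group-valued function of a tuple of group elements, given uniformly in all groups, is a word
map if it is the value of a term of the language of groups. -/
def IsWordMap {α : Type} (f : ∀ (G : Type w) [Group G], (α → G) → G) : Prop :=
  ∃ τ : groupLanguage.Term α, ∀ (G : Type w) [Group G] (x : α → G), τ.realize x = f G x

/-- A property of tuples of group elements, given uniformly in all groups, is elementary if it is
expressed by a first-order formula of the language of groups. -/
def IsElementary {α : Type} (P : ∀ (G : Type w) [Group G], (α → G) → Prop) : Prop :=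
  ∃ φ : groupLanguage.Formula α, ∀ (G : Type w) [Group G] (x : α → G), φ.Realize x ↔ P G x

namespace IsWordMap

variable {α : Type}

theorem var (i : α) : IsWordMap.{w} fun G _ (x : α → G) => x i :=
  ⟨.var i, fun _ _ _ => rfl⟩

theorem one : IsWordMap.{w} fun G _ (_ : α → G) => 1 :=
  ⟨.func GroupFunc.one ![], fun _ _ _ => rfl⟩

theorem mul {f g : ∀ (G : Type w) [Group G], (α → G) → G} (hf : IsWordMap f)
    (hg : IsWordMap g) : IsWordMap fun G _ x => f G x * g G x := by
  obtain ⟨σ, hσ⟩ := hf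
  obtain ⟨τ, hτ⟩ := hg
  exact ⟨.func GroupFunc.mul ![σ, τ], fun G _ x => congrArg₂ (· * ·) (hσ G x) (hτ G x)⟩

theorem inv {f : ∀ (G : Type w) [Group G], (α → G) → G} (hf : IsWordMap f) :
    IsWordMap fun G _ x => (f G x)⁻¹ := by
  obtain ⟨σ, hσ⟩ := hf
  exact ⟨.func GroupFunc.inv ![σ], fun G _ x => congrArg (·⁻¹) (hσ G x)⟩

theorem pow {f : ∀ (G : Type w) [Group G], (α → G) → G} (hf : IsWordMap f) (k : ℕ) :
    IsWordMap fun G _ x => f G x ^ k := by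
  induction k with
  | zero => simpa using one
  | succ k ih => simpa only [pow_succ] using ih.mul hf

theorem zpow {f : ∀ (G : Type w) [Group G], (α → G) → G} (hf : IsWordMap f) (k : ℤ) :
    IsWordMap fun G _ x => f G x ^ k := by
  cases k with
  | ofNat k => simpa using hf.pow k
  | negSucc k => simpa using (hf.pow (k + 1)).inv

theorem list_prod {ι : Type} (l : List ι) {f : ι → ∀ (G : Type w) [Group G], (α → G) → G}
    (hf : ∀ i, IsWordMap (f i)) : IsWordMap fun G _ x => (l.map fun i => f i G x).prod := by
  induction l with
  | nil => simpa using one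
  | cons i l ih => simpa using (hf i).mul ih

end IsWordMap

namespace IsElementary

variable {α : Type} {P Q : ∀ (G : Type w) [Group G], (α → G) → Prop}

theorem eq {f g : ∀ (G : Type w) [Group G], (α → G) → G} (hf : IsWordMap f)
    (hg : IsWordMap g) : IsElementary fun G _ x => f G x = g G x := by
  obtain ⟨σ, hσ⟩ := hf
  obtain ⟨τ, hτ⟩ := hg
  exact ⟨σ.equal τ, fun G _ x => by rw [Formula.realize_equal, hσ, hτ]⟩

theorem commute {f g : ∀ (G : Type w) [Group G], (α → G) → G} (hf : IsWordMap f)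
    (hg : IsWordMap g) : IsElementary fun G _ x => Commute (f G x) (g G x) :=
  eq (hf.mul hg) (hg.mul hf)

theorem not (hP : IsElementary P) : IsElementary fun G _ x => ¬ P G x := by
  obtain ⟨φ, hφ⟩ := hP
  exact ⟨φ.not, fun G _ x => by rw [Formula.realize_not, hφ]⟩

theorem ne {f g : ∀ (G : Type w) [Group G], (α → G) → G} (hf : IsWordMap f)
    (hg : IsWordMap g) : IsElementary fun G _ x => f G x ≠ g G x :=
  (eq hf hg).not

theorem imp (hP : IsElementary P) (hQ : IsElementary Q) :
    IsElementary fun G _ x => P G x → Q G x := by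
  obtain ⟨φ, hφ⟩ := hP
  obtain ⟨χ, hχ⟩ := hQ
  exact ⟨φ.imp χ, fun G _ x => by rw [Formula.realize_imp, hφ, hχ]⟩

theorem and (hP : IsElementary P) (hQ : IsElementary Q) :
    IsElementary fun G _ x => P G x ∧ Q G x := by
  obtain ⟨φ, hφ⟩ := hP
  obtain ⟨χ, hχ⟩ := hQ
  exact ⟨φ ⊓ χ, fun G _ x => by rw [Formula.realize_inf, hφ, hχ]⟩

theorem or (hP : IsElementary P) (hQ : IsElementary Q) :
    IsElementary fun G _ x => P G x ∨ Q G x := by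
  obtain ⟨φ, hφ⟩ := hP
  obtain ⟨χ, hχ⟩ := hQ
  exact ⟨φ ⊔ χ, fun G _ x => by rw [Formula.realize_sup, hφ, hχ]⟩

theorem finite_forall {ι : Type} [Finite ι] {P : ι → ∀ (G : Type w) [Group G], (α → G) → Prop}
    (hP : ∀ i, IsElementary (P i)) : IsElementary fun G _ x => ∀ i, P i G x := by
  choose φ hφ using hP
  exact ⟨BoundedFormula.iInf φ, fun G _ x => by
    simp only [Formula.Realize, BoundedFormula.realize_iInf] at hφ ⊢
    simp only [hφ]⟩

theorem finite_exists {ι : Type} [Finite ι] {P : ι → ∀ (G : Type w) [Group G], (α → G) → Prop}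
    (hP : ∀ i, IsElementary (P i)) : IsElementary fun G _ x => ∃ i, P i G x := by
  choose φ hφ using hP
  exact ⟨BoundedFormula.iSup φ, fun G _ x => by
    simp only [Formula.Realize, BoundedFormula.realize_iSup] at hφ ⊢
    simp only [hφ]⟩

theorem exists_tuple {ι : Type} [Finite ι]
    {P : ∀ (G : Type w) [Group G], (α → G) → (ι → G) → Prop}
    (hP : IsElementary fun G _ (x : α ⊕ ι → G) => P G (fun i => x (.inl i)) fun i => x (.inr i)) :
    IsElementary fun G _ x => ∃ y, P G x y := by
  obtain ⟨φ, hφ⟩ := hP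
  exact ⟨φ.iExs ι, fun G _ x => by
    simp only [Formula.realize_iExs, hφ, Sum.elim_inl, Sum.elim_inr]⟩

theorem ex {P : ∀ (G : Type w) [Group G], (α → G) → G → Prop}
    (hP : IsElementary fun G _ (x : α ⊕ Unit → G) => P G (fun i => x (.inl i)) (x (.inr ()))) :
    IsElementary fun G _ x => ∃ y, P G x y := by
  obtain ⟨φ, hφ⟩ := exists_tuple (ι := Unit) (P := fun G _ x y => P G x (y ())) hP
  exact ⟨φ, fun G _ x => (hφ G x).trans
    ⟨fun ⟨y, hy⟩ => ⟨y (), hy⟩, fun ⟨y, hy⟩ => ⟨fun _ => y, hy⟩⟩⟩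

theorem all {P : ∀ (G : Type w) [Group G], (α → G) → G → Prop}
    (hP : IsElementary fun G _ (x : α ⊕ Unit → G) => P G (fun i => x (.inl i)) (x (.inr ()))) :
    IsElementary fun G _ x => ∀ y, P G x y := by
  simpa only [not_exists, not_not] using (ex (P := fun G _ x y => ¬ P G x y) hP.not).not

end IsElementary

/-! ### The axioms and their first-order form -/

/-- The action of a polynomial `p` evaluated at conjugation by `t`, on an element `x`. -/
def polyConj {G : Type*} [Group G] (p : ℤ[X]) (t x : G) : G :=
  ((List.range (p.natDegree + 1)).map fun i => t ^ i * x ^ p.coeff i * (t ^ i)⁻¹).prod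

theorem IsWordMap.polyConj {α : Type} {f g : ∀ (G : Type w) [Group G], (α → G) → G} (p : ℤ[X])
    (hf : IsWordMap f) (hg : IsWordMap g) :
    IsWordMap fun G _ x => polyConj p (f G x) (g G x) :=
  list_prod _ fun i => ((hf.pow i).mul (hg.zpow _)).mul (hf.pow i).inv

/-- First-order conditions on elements `a` and `t` of a group, which say that the group is the
product of a normal abelian subgroup, the centralizer of `a`, and an abelian complement, the
centralizer of `t`, and restrict the action of the second on the first. -/
structure SplitAxioms (p : ℤ[X]) (N : ℕ) {G : Type*} [Group G] (a t : G) : Prop where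
  comm : ∀ x, Commute x a → ∀ y, Commute y a → Commute x y
  normal : ∀ x, Commute x a → ∀ g, Commute (g * x * g⁻¹) a
  disjoint : ∀ x, Commute x a → Commute x t → x = 1
  exists_mul : ∀ g, ∃ x, ∃ c, Commute x a ∧ Commute c t ∧ g = x * c
  comm' : ∀ c, Commute c t → ∀ d, Commute d t → Commute c d
  commute_of_commute : ∀ x, Commute x a → x ≠ 1 → ∀ g, Commute g x → Commute g a
  exists_sq : ∀ c, Commute c t → ∃ d, Commute d t ∧ (c = d * d ∨ c = t * (d * d))
  eq_one_of_sq : ∀ x, Commute x a → x * x = 1 → x = 1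
  polyConj_eq_one : ∀ x, Commute x a → polyConj p t x = 1
  not_sq : ∀ z, Commute z a → a ≠ z * z
  index_le : ∃ y : Fin N → G, (∀ i, Commute (y i) a) ∧
    ∀ x, Commute x a → ∃ z, Commute z a ∧ ∃ i, x = y i * (z * z)

/-- An explicit conjunction, to which the closure properties of `IsElementary` apply. -/
theorem splitAxioms_iff (p : ℤ[X]) (N : ℕ) {G : Type*} [Group G] (a t : G) :
    SplitAxioms p N a t ↔
      (∀ x, Commute x a → ∀ y, Commute y a → Commute x y) ∧
      (∀ x, Commute x a → ∀ g, Commute (g * x * g⁻¹) a) ∧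
      (∀ x, Commute x a → Commute x t → x = 1) ∧
      (∀ g, ∃ x, ∃ c, Commute x a ∧ Commute c t ∧ g = x * c) ∧
      (∀ c, Commute c t → ∀ d, Commute d t → Commute c d) ∧
      (∀ x, Commute x a → x ≠ 1 → ∀ g, Commute g x → Commute g a) ∧
      (∀ c, Commute c t → ∃ d, Commute d t ∧ (c = d * d ∨ c = t * (d * d))) ∧
      (∀ x, Commute x a → x * x = 1 → x = 1) ∧
      (∀ x, Commute x a → polyConj p t x = 1) ∧
      (∀ z, Commute z a → a ≠ z * z) ∧
      ∃ y : Fin N → G, (∀ i, Commute (y i) a) ∧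
        ∀ x, Commute x a → ∃ z, Commute z a ∧ ∃ i, x = y i * (z * z) :=
  ⟨fun ⟨h1, h2, h3, h4, h5, h6, h7, h8, h9, h10, h11⟩ =>
    ⟨h1, h2, h3, h4, h5, h6, h7, h8, h9, h10, h11⟩,
   fun ⟨h1, h2, h3, h4, h5, h6, h7, h8, h9, h10, h11⟩ =>
    ⟨h1, h2, h3, h4, h5, h6, h7, h8, h9, h10, h11⟩⟩

theorem exists_sentence_splitAxioms (p : ℤ[X]) (N : ℕ) :
    ∃ ψ : groupLanguage.Sentence, ∀ (G : Type w) [Group G],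
      Sentence.Realize G ψ ↔ ∃ a t : G, SplitAxioms p N a t := by
  suffices h : IsElementary fun G _ (_ : Empty → G) => ∃ a t : G, SplitAxioms p N a t by
    obtain ⟨φ, hφ⟩ := h
    exact ⟨φ, fun G _ => hφ G _⟩
  simp only [splitAxioms_iff]
  refine .ex <| .ex <| .and ?_ <| .and ?_ <| .and ?_ <| .and ?_ <| .and ?_ <| .and ?_ <|
    .and ?_ <| .and ?_ <| .and ?_ <| .and ?_ <| .exists_tuple <| .and (.finite_forall fun i => ?_)
    <| .all <| .imp ?_ <| .ex <| .and ?_ <| .finite_exists fun i => ?_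
  all_goals
    repeat' first
      | exact IsWordMap.var _
      | exact IsWordMap.one
      | apply IsWordMap.mul
      | apply IsWordMap.inv
      | apply IsWordMap.polyConj
      | apply IsElementary.commute
      | apply IsElementary.ne
      | apply IsElementary.eq
      | apply IsElementary.and
      | apply IsElementary.or
      | apply IsElementary.ex
      | apply IsElementary.imp
      | apply IsElementary.all

/-! ### Finiteness and modules over a domain finite and free over ℤ -/

/-- A finitely generated commutative group in which every element is a square is finite. -/
theorem finite_of_fg_of_forall_exists_sq (Q : Type*) [CommGroup Q] [Group.FG Q]
    (hsq : ∀ q : Q, ∃ r, q = r * r) : Finite Q := by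
  have hfin : Module.Finite ℤ (Additive Q) := inferInstance
  -- Nakayama's lemma: since Q = 2Q in additive notation, some n ≡ 1 mod 2 annihilates Q.
  obtain ⟨n, hn, hn0⟩ := Submodule.exists_sub_one_mem_and_smul_eq_zero_of_fg_of_le_smul
    (Ideal.span {(2 : ℤ)}) (⊤ : Submodule ℤ (Additive Q)) hfin.1 (by
      intro q _
      obtain ⟨r, hr⟩ := hsq q.toMul
      have : q = (2 : ℤ) • Additive.ofMul r := by
        rw [two_zsmul, ← ofMul_mul, ← hr, ofMul_toMul]
      rw [this]
      exact Submodule.smul_mem_smul (Ideal.mem_span_singleton_self 2) trivial)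
  have hne : n ≠ 0 := by
    rintro rfl
    obtain ⟨k, hk⟩ := Ideal.mem_span_singleton.1 hn
    omega
  have : Finite (Additive Q) := Module.finite_of_fg_torsion _ fun {x} =>
    ⟨⟨n, mem_nonZeroDivisors_of_ne_zero hne⟩, hn0 x trivial⟩
  exact Finite.of_equiv _ Additive.toMul

section Ring

variable {R : Type*} [CommRing R] [IsDomain R]

/-- The ring R/(r) is finite, and its order annihilates 1. -/
theorem exists_pos_dvd_natCast [Module.Free ℤ R] [Module.Finite ℤ R] {r : R} (hr : r ≠ 0) : ∃ N : ℕ, 0 < N ∧ r ∣ (N : R) := by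
  have : Finite (R ⧸ Ideal.span {r}) :=
    Ideal.finiteQuotientOfFreeOfNeBot _ (by simpa [Ideal.span_singleton_eq_bot] using hr)
  refine ⟨Nat.card (R ⧸ Ideal.span {r}), Nat.card_pos, ?_⟩
  rw [← Ideal.mem_span_singleton, ← Ideal.Quotient.eq_zero_iff_mem, map_natCast,
    ← nsmul_one, card_nsmul_eq_zero']

/-- The image of `v` in the finite ring R/(r) is a unit of finite order. -/
theorem exists_pos_dvd_pow_sub_one [Module.Free ℤ R] [Module.Finite ℤ R] (v : Rˣ) {r : R} (hr : r ≠ 0) :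
    ∃ m : ℕ, 0 < m ∧ r ∣ (v : R) ^ m - 1 := by
  have : Finite (R ⧸ Ideal.span {r}) :=
    Ideal.finiteQuotientOfFreeOfNeBot _ (by simpa [Ideal.span_singleton_eq_bot] using hr)
  obtain ⟨m, hm, h⟩ := (isOfFinOrder_of_finite
    (Units.map (Ideal.Quotient.mk (Ideal.span {r})).toMonoidHom v)).exists_pow_eq_one
  refine ⟨m, hm, ?_⟩
  rw [← Ideal.mem_span_singleton, ← Ideal.Quotient.eq_zero_iff_mem, map_sub, map_pow, map_one,
    sub_eq_zero]
  simpa using congrArg Units.val h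

variable {M : Type*} [AddCommGroup M] [Module R M]

/-- A finitely generated module annihilated by a non-zero element is finite. -/
theorem finite_of_forall_smul_eq_zero [Module.Free ℤ R] [Module.Finite ℤ R]
    [Module.Finite R M] {r : R} (hr : r ≠ 0)
    (h : ∀ x : M, r • x = 0) : Finite M := by
  have : Module.Finite ℤ M := .trans R M
  obtain ⟨N, hN, s, hs⟩ := exists_pos_dvd_natCast hr
  refine Module.finite_of_fg_torsion _ fun {x} =>
    ⟨⟨(N : ℤ), mem_nonZeroDivisors_of_ne_zero (by exact_mod_cast hN.ne')⟩, ?_⟩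
  change (N : ℤ) • x = 0
  rw [natCast_zsmul, ← Nat.cast_smul_eq_nsmul R, hs, mul_comm, mul_smul, h, smul_zero]

/-- A torsion-free module whose rank over `ℤ` is at most that of `R` embeds in `R`. -/
theorem exists_injective_of_finrank_le [CharZero R] [Module.Finite ℤ R] [Module.Finite R M]
    [Module.IsTorsionFree R M] (h : Module.finrank ℤ M ≤ Module.finrank ℤ R) {a : M}
    (ha : a ≠ 0) : ∃ φ : M →ₗ[R] R, Function.Injective φ := by
  have : Module.Finite ℤ M := .trans R M
  have : Module.IsTorsionFree ℤ M := .trans R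
  have : Module.Free ℤ M := Module.free_of_finite_type_torsion_free'
  -- The submodule Ra is a copy of R, so it has full rank and finite index N. Multiplication by N
  -- then maps M injectively into Ra ≅ R.
  let f : R →ₗ[R] M := LinearMap.toSpanSingleton R M a
  have hf : Function.Injective f := smul_left_injective R ha
  have hfin : Finite (M ⧸ (f.restrictScalars ℤ).range) := by
    apply Submodule.finiteQuotientOfFreeOfRankEq
    rw [LinearMap.finrank_range_of_inj (f := f.restrictScalars ℤ) hf]
    exact le_antisymm
      (LinearMap.finrank_le_finrank_of_injective (f := f.restrictScalars ℤ) hf) h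
  set N := Nat.card (M ⧸ (f.restrictScalars ℤ).range)
  have hN : (N : R) ≠ 0 := Nat.cast_ne_zero.2 Nat.card_pos.ne'
  have hmem : ∀ x : M, (N : R) • x ∈ f.range := by
    intro x
    have : (N : ℤ) • x ∈ (f.restrictScalars ℤ).range := by
      rw [← Submodule.Quotient.mk_eq_zero, Submodule.Quotient.mk_smul, natCast_zsmul]
      exact card_nsmul_eq_zero'
    rwa [natCast_zsmul, ← Nat.cast_smul_eq_nsmul R] at this
  refine ⟨(LinearEquiv.ofInjective f hf).symm ∘ₗ (LinearMap.lsmul R M N).codRestrict _ hmem, ?_⟩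
  rw [LinearMap.coe_comp]
  refine (LinearEquiv.injective _).comp fun x y hxy => ?_
  exact smul_right_injective M hN (congrArg Subtype.val hxy)

/-- A linear endomorphism of a module which embeds in `R`, with a power given by a scalar, is
itself given by a scalar when `R` is integrally closed. -/
theorem exists_smul_of_pow_smul [IsIntegrallyClosed R] {φ : M →ₗ[R] R}
    (hφ : Function.Injective φ) {a : M} (ha : a ≠ 0) (f : Module.End R M) {m : ℕ} (hm : m ≠ 0)
    {s : R} (h : ∀ x, (f ^ m) x = s • x) : ∃ r : R, r ^ m = s ∧ ∀ x, f x = r • x := by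
  have ha' : φ a ≠ 0 := fun h0 => ha (hφ (by simpa using h0))
  -- In the fraction field, `f` is multiplication by φ(f a)/φ(a).
  have key : ∀ x, φ a * φ (f x) = φ (f a) * φ x := by
    intro x
    have h1 : φ x • a = φ a • x := hφ (by simp [mul_comm])
    have h2 := congrArg (fun y => φ (f y)) h1
    simp only [map_smul, smul_eq_mul] at h2
    rw [← h2, mul_comm]
  have key' : ∀ k x, φ a ^ k * φ ((f ^ k) x) = φ (f a) ^ k * φ x := by
    intro k
    induction k with
    | zero => simp
    | succ k ih =>
      intro x
      rw [pow_succ f, Module.End.mul_apply, pow_succ, mul_right_comm, ih, mul_right_comm, mul_assoc,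
        key, pow_succ, mul_assoc]
  -- The m-th power of that fraction is `s`, so integral closedness puts the fraction itself in R.
  have hdvd : φ a ^ m ∣ φ (f a) ^ m := by
    refine ⟨s, mul_right_cancel₀ ha' ?_⟩
    rw [← key', h]
    simp only [map_smul, smul_eq_mul]
    ring
  obtain ⟨r, hr⟩ := (IsIntegrallyClosed.pow_dvd_pow_iff hm).1 hdvd
  have hfx : ∀ x, f x = r • x := by
    intro x
    apply hφ
    apply mul_left_cancel₀ ha'
    rw [key, hr, map_smul, smul_eq_mul, mul_assoc]
  refine ⟨r, mul_right_cancel₀ ha' ?_, hfx⟩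
  have hk : ∀ k, (f ^ k) a = r ^ k • a := by
    intro k
    induction k with
    | zero => simp
    | succ k ih => rw [pow_succ', Module.End.mul_apply, ih, map_smul, hfx, smul_smul, pow_succ]
  simpa using congrArg φ ((hk m).symm.trans (h a))

end Ring

/-! ### An abelian group acting linearly on a module -/

section Action

variable {R M C : Type*} [CommRing R] [AddCommGroup M] [Module R M] [CommGroup C]
  (ρ : C →* Module.End R M) (v : Rˣ) {t : C}

theorem map_zpow_apply_of_map_eq_smul (ht : ∀ x, ρ t x = v • x) (k : ℤ) (x : M) :
    ρ (t ^ k) x = (v ^ k) • x := by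
  induction k using Int.induction_on with
  | zero => simp
  | succ k ih =>
    rw [zpow_add_one, mul_comm, map_mul, Module.End.mul_apply, ih, ht, smul_smul,
      zpow_add_one, mul_comm]
  | pred k ih =>
    have : v • ρ (t ^ (-(k : ℤ) - 1)) x = v ^ (-(k : ℤ)) • x := by
      rw [← ih, ← ht, ← Module.End.mul_apply, ← map_mul, mul_comm, ← zpow_add_one,
        sub_add_cancel]
    rw [zpow_sub_one v, mul_comm, mul_smul, ← this, inv_smul_smul]

/-- A module generated by finitely many elements under scalars and a commuting group action, in
which a subgroup of finite index acts by scalars, is finitely generated. -/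
theorem finite_of_finite_quotient_zpowers (ht : ∀ x, ρ t x = v • x)
    [Finite (C ⧸ Subgroup.zpowers t)] {F : Set M} (hF : F.Finite)
    (hgen : ∀ L : Submodule R M, F ⊆ L → (∀ c, ∀ x ∈ L, ρ c x ∈ L) → L = ⊤) :
    Module.Finite R M := by
  -- Translates of F by coset representatives suffice: any `c` differs from its representative by a
  -- power of `t`, which acts as a scalar.
  let S : Set M := ⋃ q : C ⧸ Subgroup.zpowers t, ρ q.out '' F
  have hmem : ∀ c, ∀ x ∈ F, ρ c x ∈ Submodule.span R S := by
    intro c x hx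
    obtain ⟨⟨_, k, rfl⟩, hk⟩ := QuotientGroup.mk_out_eq_mul (Subgroup.zpowers t) c
    have : c = t ^ (-k) * (c : C ⧸ Subgroup.zpowers t).out := by
      rw [hk, mul_comm, mul_assoc]
      simp
    rw [this, map_mul, Module.End.mul_apply, map_zpow_apply_of_map_eq_smul ρ v ht, Units.smul_def]
    exact Submodule.smul_mem _ _ (Submodule.subset_span (Set.mem_iUnion.2 ⟨_, x, hx, rfl⟩))
  have hS : S.Finite := Set.finite_iUnion fun q => hF.image _
  refine ⟨⟨hS.toFinset, ?_⟩⟩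
  rw [Set.Finite.coe_toFinset]
  refine hgen _ (fun x hx => by simpa using hmem 1 x hx) fun c x hx => ?_
  induction hx using Submodule.span_induction with
  | mem x hx =>
    obtain ⟨q, y, hy, rfl⟩ := Set.mem_iUnion.1 hx
    rw [← Module.End.mul_apply, ← map_mul]
    exact hmem _ y hy
  | zero => simp
  | add x y _ _ hx hy => rw [map_add]; exact Submodule.add_mem _ hx hy
  | smul r x _ hx => rw [map_smul]; exact Submodule.smul_mem _ _ hx

/-- The `y i` represent all classes of M/2M, which has 2^rank elements. -/
theorem finrank_le_of_forall_exists_add {M : Type*} [AddCommGroup M] [Module.Free ℤ M] [Module.Finite ℤ M] {n : ℕ}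
    (y : Fin (2 ^ n) → M) (hy : ∀ x, ∃ z, ∃ i, x = y i + (z + z)) : Module.finrank ℤ M ≤ n := by
  have h := ModN.natCard_eq M 2
  have hsurj : Function.Surjective fun i => ModN.mkQ 2 (y i) := by
    intro q
    obtain ⟨x, rfl⟩ := Submodule.Quotient.mk_surjective _ q
    obtain ⟨z, i, rfl⟩ := hy x
    refine ⟨i, ?_⟩
    exact ((Submodule.Quotient.eq _).2 ⟨-z, by simp; abel⟩)
  have hle := Nat.card_le_card_of_surjective _ hsurj
  rw [h, Nat.card_fin] at hle
  exact (Nat.pow_le_pow_iff_right one_lt_two).1 hle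

/-- The module-theoretic core of the converse: M stands for the normal subgroup A, and C for its
complement acting by conjugation. -/
theorem zpowers_eq_top_and_exists_injective [IsDomain R] [Module.Free ℤ R] [Module.Finite ℤ R] [CharZero R] [IsIntegrallyClosed R] [Group.FG C]
    (hv : ∀ k : ℤ, v ^ k = 1 → k = 0) (hunits : ∀ w : Rˣ, ∃ k : ℤ, w = v ^ k ∨ w = -v ^ k)
    (ht : ∀ x, ρ t x = v • x) (hfree : ∀ c x, ρ c x = x → x ≠ 0 → c = 1)
    (hsq : ∀ c, ∃ d, c = d * d ∨ c = t * (d * d)) (htwo : ∀ x : M, x + x = 0 → x = 0)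
    {a : M} (ha : ∀ z, a ≠ z + z) (y : Fin (2 ^ Module.finrank ℤ R) → M)
    (hy : ∀ x, ∃ z, ∃ i, x = y i + (z + z)) {F : Set M} (hF : F.Finite)
    (hgen : ∀ L : Submodule R M, F ⊆ L → (∀ c, ∀ x ∈ L, ρ c x ∈ L) → L = ⊤) :
    Subgroup.zpowers t = ⊤ ∧ (∀ k : ℤ, t ^ k = 1 → k = 0) ∧
      ∃ φ : M →ₗ[R] R, Function.Injective φ ∧ φ a ≠ 0 := by
  have ha0 : a ≠ 0 := by simpa using ha 0
  have hQ : Finite (C ⧸ Subgroup.zpowers t) := by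
    apply finite_of_fg_of_forall_exists_sq
    intro q
    obtain ⟨c, rfl⟩ := QuotientGroup.mk_surjective q
    obtain ⟨d, rfl | rfl⟩ := hsq c
    · exact ⟨d, rfl⟩
    · refine ⟨d, ?_⟩
      rw [QuotientGroup.mk_mul, (QuotientGroup.eq_one_iff t).2 (Subgroup.mem_zpowers t), one_mul]
      rfl
  have hfin : Module.Finite R M := finite_of_finite_quotient_zpowers ρ v ht hF hgen
  -- If t^k = 1 with k ≠ 0, then v^k - 1 annihilates M, which is therefore finite. Doubling, being
  -- injective, is then surjective, against the choice of `a`.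
  have htord : ∀ k : ℤ, t ^ k = 1 → k = 0 := by
    intro k hk
    by_contra hk0
    have hs : ((v ^ k : Rˣ) : R) - 1 ≠ 0 := by
      rw [sub_ne_zero]
      exact fun h => hk0 (hv k (Units.ext h))
    have : Finite M := finite_of_forall_smul_eq_zero hs fun x => by
      rw [sub_smul, one_smul, ← Units.smul_def, ← map_zpow_apply_of_map_eq_smul ρ v ht, hk]
      simp
    have hinj : Function.Injective fun x : M => x + x := by
      intro x z hxz
      rw [← sub_eq_zero]
      apply htwo
      have : x + x = z + z := hxz
      rw [sub_add_sub_comm, this, sub_self]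
    obtain ⟨z, hz⟩ := Finite.surjective_of_injective hinj a
    exact ha z hz.symm
  -- If r kills x ≠ 0 and r divides v^m - 1, then t^m fixes x, so t^m = 1 with m > 0.
  have htf : Module.IsTorsionFree R M := by
    refine .of_smul_eq_zero fun r x hrx => ?_
    by_contra! h
    obtain ⟨m, hm, s, hs⟩ := exists_pos_dvd_pow_sub_one v h.1
    have hfix : ρ (t ^ (m : ℤ)) x = x := by
      rw [map_zpow_apply_of_map_eq_smul ρ v ht, Units.smul_def, zpow_natCast, Units.val_pow_eq_pow_val,
        ← sub_add_cancel ((v : R) ^ m) 1, hs, mul_comm, add_smul, mul_smul, hrx]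
      simp
    have := htord _ (hfree _ _ hfix h.2)
    omega
  have : Module.Finite ℤ M := .trans R M
  have : Module.IsTorsionFree ℤ M := .trans R
  have : Module.Free ℤ M := Module.free_of_finite_type_torsion_free'
  obtain ⟨φ, hφ⟩ := exists_injective_of_finrank_le (finrank_le_of_forall_exists_add y hy) ha0
  refine ⟨?_, htord, φ, hφ, fun h => ha0 (hφ (by simpa using h))⟩
  have hsq_mem : ∀ c : C, c * c ∈ Subgroup.zpowers t := by
    intro c
    obtain ⟨m, hm, hcm⟩ := (isOfFinOrder_of_finite
      (c : C ⧸ Subgroup.zpowers t)).exists_pow_eq_one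
    rw [← QuotientGroup.mk_pow, QuotientGroup.eq_one_iff] at hcm
    obtain ⟨k, hk⟩ := hcm
    obtain ⟨r, hr, hrc⟩ := exists_smul_of_pow_smul hφ ha0 (ρ c) hm.ne'
      (s := ((v ^ k : Rˣ) : R)) fun x => by
        rw [← map_pow, ← hk, ← Units.smul_def]
        exact map_zpow_apply_of_map_eq_smul ρ v ht k x
    obtain ⟨w, rfl⟩ : IsUnit r := (isUnit_pow_iff hm.ne').1 (hr ▸ Units.isUnit _)
    obtain ⟨j, hj⟩ := hunits w
    -- Squaring removes the sign in w = ±v^j, so `c * c` acts as `t ^ (j + j)` and equals it by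
    -- freeness of the action.
    have hww : w * w = v ^ (j + j) := by
      rw [zpow_add]
      rcases hj with rfl | rfl <;> simp
    refine ⟨j + j, ?_⟩
    rw [eq_comm, ← mul_inv_eq_one, ← zpow_neg]
    refine hfree _ a ?_ ha0
    rw [map_mul, Module.End.mul_apply, map_zpow_apply_of_map_eq_smul ρ v ht, map_mul,
      Module.End.mul_apply, hrc, hrc, ← Units.smul_def, ← Units.smul_def, smul_smul, smul_smul, hww,
      zpow_neg, mul_inv_cancel, one_smul]
  rw [eq_top_iff]
  rintro c -
  obtain ⟨d, rfl | rfl⟩ := hsq c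
  · exact hsq_mem d
  · exact mul_mem (Subgroup.mem_zpowers t) (hsq_mem d)

end Action

/-! ### Split extensions satisfy the axioms -/

theorem polyConj_map_ofAdd {G M : Type*} [Group G] [AddCommGroup M] (j : Multiplicative M →* G)
    {t : G} {T : Module.End ℤ M}
    (h : ∀ x, t * j (.ofAdd x) * t⁻¹ = j (.ofAdd (T x))) (p : ℤ[X]) (x : M) :
    polyConj p t (j (.ofAdd x)) = j (.ofAdd (aeval T p x)) := by
  have hpow : ∀ (i : ℕ) (y : M), t ^ i * j (.ofAdd y) * (t ^ i)⁻¹ = j (.ofAdd ((T ^ i) y)) := by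
    intro i
    induction i with
    | zero => simp
    | succ i ih =>
      intro y
      rw [pow_succ' T, Module.End.mul_apply, ← h, ← ih, pow_succ', mul_inv_rev]
      simp only [mul_assoc]
  have hsum : ∀ n : ℕ, ((List.range n).map fun i =>
      t ^ i * j (.ofAdd x) ^ p.coeff i * (t ^ i)⁻¹).prod =
      j (.ofAdd ((∑ i ∈ Finset.range n, p.coeff i • T ^ i) x)) := by
    intro n
    induction n with
    | zero => simp
    | succ n ih =>
      rw [List.range_succ, List.map_append, List.prod_append, ih, Finset.sum_range_succ,
        LinearMap.add_apply, ofAdd_add, map_mul, List.map_singleton, List.prod_singleton,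
        ← map_zpow, ← ofAdd_zsmul, hpow, map_zsmul, LinearMap.smul_apply]
  rw [aeval_eq_sum_range]
  exact hsum _

/-- A presentation of a group `G` as the semidirect product of the additive group `M`, embedded
by `j`, with the infinite cyclic group generated by `t`, which acts on `M` as the unit `v`. -/
structure IsSplit {R M G : Type*} [CommRing R] [AddCommGroup M] [Module R M] [Group G] (v : Rˣ)
    (j : Multiplicative M →* G) (t : G) : Prop where
  injective : Function.Injective j
  conj : ∀ x, t * j (.ofAdd x) * t⁻¹ = j (.ofAdd (v • x))
  exists_eq : ∀ g, ∃ x, ∃ k : ℤ, g = j (.ofAdd x) * t ^ k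
  eq_zero : ∀ x, ∀ k : ℤ, j (.ofAdd x) = t ^ k → k = 0

namespace IsSplit

variable {R M G : Type*} [CommRing R] [AddCommGroup M] [Module R M] [Group G] {v : Rˣ}
  {j : Multiplicative M →* G} {t : G}

theorem conj_zpow (h : IsSplit v j t) (k : ℤ) (x : M) :
    t ^ k * j (.ofAdd x) * (t ^ k)⁻¹ = j (.ofAdd (v ^ k • x)) := by
  induction k using Int.induction_on with
  | zero => simp
  | succ k ih =>
    rw [add_comm, zpow_add, zpow_add, mul_smul, zpow_one, zpow_one, ← h.conj, ← ih]
    group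
  | pred k ih =>
    have h1 := h.conj (v ^ (-(k : ℤ) - 1) • x)
    rw [smul_smul, ← zpow_one_add, add_sub_cancel, ← ih] at h1
    rw [eq_comm, ← mul_right_inj t, ← mul_left_inj t⁻¹, h1]
    group

theorem mulEquiv (h : IsSplit v j t) {M' : Type*} [AddCommGroup M'] [Module R M']
    (e : M' ≃ₗ[R] M) : IsSplit v (j.comp (AddMonoidHom.toMultiplicative e.toAddMonoidHom)) t where
  injective := h.injective.comp e.injective
  conj x := (h.conj (e x)).trans (congrArg (fun y => j (.ofAdd y)) (map_smul e (v : R) x).symm)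
  exists_eq g := by
    obtain ⟨x, k, hg⟩ := h.exists_eq g
    refine ⟨e.symm x, k, hg.trans ?_⟩
    simp
  eq_zero x k hk := h.eq_zero (e x) k hk

theorem fg [Module.Finite ℤ M] (h : IsSplit v j t) : Group.FG G := by
  have : AddGroup.FG M := Module.Finite.iff_addGroup_fg.1 inferInstance
  obtain ⟨S, hS, hfin⟩ := Group.fg_iff.1 (inferInstance : Group.FG (Multiplicative M))
  refine Group.fg_iff.2 ⟨insert t (j '' S), ?_, (hfin.image j).insert t⟩
  rw [eq_top_iff]
  rintro g -
  obtain ⟨x, k, rfl⟩ := h.exists_eq g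
  refine mul_mem ?_ (zpow_mem (Subgroup.subset_closure (Set.mem_insert _ _)) k)
  have : j (.ofAdd x) ∈ (Subgroup.closure S).map j := ⟨_, hS ▸ Subgroup.mem_top _, rfl⟩
  rw [MonoidHom.map_closure] at this
  exact Subgroup.closure_mono (Set.subset_insert _ _) this

variable [IsDomain R] [Module.IsTorsionFree R M]

/-- Conjugation by `j y * t ^ k` sends x to v^k x. Without torsion, fixing x ≠ 0 forces v^k = 1. -/
theorem commute_ofAdd_iff (h : IsSplit v j t) (hv : ∀ k : ℤ, v ^ k = 1 → k = 0) {x : M}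
    (hx : x ≠ 0) (g : G) : Commute g (j (.ofAdd x)) ↔ ∃ y, g = j (.ofAdd y) := by
  constructor
  · intro hg
    obtain ⟨y, k, rfl⟩ := h.exists_eq g
    have h1 : j (.ofAdd y) * t ^ k * j (.ofAdd x) * (j (.ofAdd y) * t ^ k)⁻¹ = j (.ofAdd x) := by
      rw [hg.eq, mul_inv_cancel_right]
    have h2 : j (.ofAdd y) * t ^ k * j (.ofAdd x) * (j (.ofAdd y) * t ^ k)⁻¹ =
        j (.ofAdd (v ^ k • x)) := by
      rw [mul_inv_rev, ← mul_assoc, mul_assoc (j _) (t ^ k), mul_assoc (j _), h.conj_zpow, ← map_mul,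
        mul_comm, map_mul, mul_inv_cancel_right]
    have h3 : (v ^ k) • x = x := by
      simpa using h.injective (h2.symm.trans h1)
    have h4 : v ^ k = 1 := by
      apply Units.ext
      have : (((v ^ k : Rˣ) : R) - 1) • x = 0 := by
        rw [sub_smul, one_smul, ← Units.smul_def, h3, sub_self]
      exact sub_eq_zero.1 ((smul_eq_zero.1 this).resolve_right hx)
    exact ⟨y, by rw [h4 |> hv k, zpow_zero, mul_one]⟩
  · rintro ⟨y, rfl⟩
    exact (Commute.all _ _).map j

/-- If `j y * t ^ k` commutes with `t`, so does `j y`. Hence v - 1, which is not zero, kills y. -/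
theorem commute_iff (h : IsSplit v j t) (hv : ∀ k : ℤ, v ^ k = 1 → k = 0) (g : G) :
    Commute g t ↔ ∃ k : ℤ, g = t ^ k := by
  constructor
  · intro hg
    obtain ⟨y, k, rfl⟩ := h.exists_eq g
    have h1 : Commute t (j (.ofAdd y)) := by
      simpa using (hg.mul_left ((Commute.refl t).zpow_left k).inv_left).symm
    have h2 : v • y = y := by
      have := h.conj y
      rw [h1.eq, mul_inv_cancel_right] at this
      simpa using (h.injective this).symm
    have h3 : ((v : R) - 1) • y = 0 := by
      rw [sub_smul, one_smul, ← Units.smul_def, h2, sub_self]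
    refine ⟨k, ?_⟩
    rcases smul_eq_zero.1 h3 with h4 | rfl
    · exact absurd (hv 1 (by rw [zpow_one]; exact Units.ext (sub_eq_zero.1 h4))) one_ne_zero
    · simp
  · rintro ⟨k, rfl⟩
    exact (Commute.refl t).zpow_left k

theorem splitAxioms [CharZero R] [Module.Free ℤ M] [Module.Finite ℤ M] (h : IsSplit v j t)
    (hv : ∀ k : ℤ, v ^ k = 1 → k = 0) {p : ℤ[X]} (hp : aeval (v : R) p = 0) {a : M}
    (ha : ∀ z, a ≠ z + z) : SplitAxioms p (2 ^ Module.finrank ℤ M) (j (.ofAdd a)) t := by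
  have ha0 : a ≠ 0 := by simpa using ha 0
  have hA := h.commute_ofAdd_iff hv ha0
  have hC := h.commute_iff hv
  constructor
  all_goals simp only [hA, hC]
  · rintro _ ⟨x, rfl⟩ _ ⟨y, rfl⟩
    exact (Commute.all _ _).map j
  · rintro _ ⟨x, rfl⟩ g
    obtain ⟨y, k, rfl⟩ := h.exists_eq g
    refine ⟨v ^ k • x, ?_⟩
    rw [mul_inv_rev, ← mul_assoc, mul_assoc (j _) (t ^ k), mul_assoc (j _), h.conj_zpow, ← map_mul,
      mul_comm, map_mul, mul_inv_cancel_right]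
  · rintro _ ⟨x, rfl⟩ ⟨k, hk⟩
    rw [hk, h.eq_zero x k hk, zpow_zero]
  · intro g
    obtain ⟨y, k, rfl⟩ := h.exists_eq g
    exact ⟨_, _, ⟨y, rfl⟩, ⟨k, rfl⟩, rfl⟩
  · rintro _ ⟨k, rfl⟩ _ ⟨l, rfl⟩
    exact Commute.zpow_zpow_self t k l
  · rintro _ ⟨x, rfl⟩ hx g hg
    exact (h.commute_ofAdd_iff hv (by rintro rfl; simp at hx) g).1 hg
  · rintro _ ⟨k, rfl⟩
    refine ⟨t ^ (k / 2), ⟨_, rfl⟩, ?_⟩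
    rw [← zpow_add, ← zpow_one_add]
    rcases Int.emod_two_eq_zero_or_one k with hk | hk
    · exact .inl (congrArg (t ^ ·) (by omega))
    · exact .inr (congrArg (t ^ ·) (by omega))
  · rintro _ ⟨x, rfl⟩ hx
    rw [← map_mul, ← ofAdd_add, map_eq_one_iff j h.injective, ofAdd_eq_one, ← two_smul R] at hx
    rw [(smul_eq_zero.1 hx).resolve_left two_ne_zero, ofAdd_zero, map_one]
  · rintro _ ⟨x, rfl⟩
    rw [polyConj_map_ofAdd j (T := Algebra.lsmul ℤ ℤ M (v : R)) h.conj, aeval_algHom_apply, hp]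
    simp
  · rintro _ ⟨z, rfl⟩ hz
    rw [← map_mul, ← ofAdd_add] at hz
    exact ha z (h.injective hz)
  -- The tuple consists of representatives of the 2^rank classes of M/2M.
  · have hfin : Finite (ModN M 2) := inferInstance
    obtain ⟨e⟩ : Nonempty (Fin (2 ^ Module.finrank ℤ M) ≃ ModN M 2) := by
      rw [← ModN.natCard_eq M 2]
      exact ⟨(Finite.equivFin _).symm⟩
    refine ⟨fun i => j (.ofAdd (e i).out), fun i => ⟨_, rfl⟩, ?_⟩
    rintro _ ⟨x, rfl⟩
    have hx : (Submodule.Quotient.mk (e (e.symm (Submodule.Quotient.mk x))).out : ModN M 2) =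
        Submodule.Quotient.mk x := by
      rw [e.apply_symm_apply]
      exact Quotient.out_eq _
    obtain ⟨z, hz⟩ := (Submodule.Quotient.eq _).1 hx.symm
    refine ⟨_, ⟨z, rfl⟩, e.symm (Submodule.Quotient.mk x), ?_⟩
    rw [← map_mul, ← map_mul, ← ofAdd_add, ← ofAdd_add]
    congr 2
    rw [← sub_eq_iff_eq_add', ← hz]
    simp [two_smul]

end IsSplit

/-! ### Split presentations and semidirect products by ideals -/

section Ideal

variable {R G : Type*} [CommRing R] [Group G] {v : Rˣ} {I : Ideal R}

theorem isSplit_of_mulEquiv (hv : ∀ k : ℤ, v ^ k = 1 → k = 0) (e : G ≃* IdealSemidirect I v) :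
    IsSplit v (e.symm.toMonoidHom.comp SemidirectProduct.inl)
      (e.symm (SemidirectProduct.inr ⟨v, Subgroup.mem_zpowers v⟩)) where
  injective := e.symm.injective.comp SemidirectProduct.inl_injective
  conj x := by
    change e.symm _ * e.symm _ * (e.symm _)⁻¹ = e.symm _
    rw [← map_inv, ← map_mul, ← map_mul, ← map_inv]
    exact congrArg e.symm (SemidirectProduct.inl_aut _ _).symm
  exists_eq g := by
    obtain ⟨⟨w, k, hk⟩, hw⟩ : ∃ w, w = (e g).right := ⟨_, rfl⟩
    refine ⟨(e g).left.toAdd, k, e.injective ?_⟩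
    have hr : (⟨v, Subgroup.mem_zpowers v⟩ : Subgroup.zpowers v) ^ k = (e g).right := by
      rw [← hw]
      exact Subtype.ext hk
    simp only [MonoidHom.comp_apply, map_mul, map_zpow, MulEquiv.apply_symm_apply,
      MulEquiv.coe_toMonoidHom, ofAdd_toAdd]
    rw [← map_zpow, hr, SemidirectProduct.inl_left_mul_inr_right]
  eq_zero x k hk := by
    change e.symm _ = _ at hk
    rw [← map_zpow, e.symm.apply_eq_iff_eq, ← map_zpow] at hk
    have := congrArg SemidirectProduct.right hk
    simp only [SemidirectProduct.right_inl, SemidirectProduct.right_inr] at this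
    exact hv k (congrArg Subtype.val this).symm

theorem IsSplit.nonempty_mulEquiv {j : Multiplicative I →* G} {t : G} (h : IsSplit v j t)
    (hv : ∀ k : ℤ, v ^ k = 1 → k = 0) : Nonempty (G ≃* IdealSemidirect I v) := by
  have hinj : Function.Injective ((zpowersHom Rˣ v).rangeRestrict) := by
    rw [MonoidHom.rangeRestrict_injective_iff, injective_iff_map_eq_one]
    intro k hk
    exact hv _ hk
  let e : Multiplicative ℤ ≃* Subgroup.zpowers v :=
    MulEquiv.ofBijective (zpowersHom Rˣ v).rangeRestrict
      ⟨hinj, (zpowersHom Rˣ v).rangeRestrict_surjective⟩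
  have he : ∀ k : ℤ, ((e (.ofAdd k) : Subgroup.zpowers v) : Rˣ) = v ^ k := fun _ => rfl
  let f : IdealSemidirect I v →* G :=
    SemidirectProduct.lift j ((zpowersHom G t).comp e.symm.toMonoidHom) fun w => by
      obtain ⟨k, rfl⟩ := e.surjective w
      refine MonoidHom.ext fun x => ?_
      have := h.conj_zpow k.toAdd x.toAdd
      simp only [MonoidHom.comp_apply, MulEquiv.coe_toMonoidHom, MulEquiv.symm_apply_apply,
        zpowersHom_apply]
      exact this.symm
  have hf : ∀ x k, f (SemidirectProduct.inl x * SemidirectProduct.inr (e k)) =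
      j x * t ^ k.toAdd := by
    intro x k
    simp [f]
  refine ⟨(MulEquiv.ofBijective f ⟨?_, fun g => ?_⟩).symm⟩
  · rw [injective_iff_map_eq_one]
    intro g hg
    obtain ⟨k, hk⟩ := e.surjective g.right
    rw [← SemidirectProduct.inl_left_mul_inr_right g, ← hk, hf] at hg
    have hk0 := h.eq_zero g.left.toAdd (-k.toAdd) (by
      rw [zpow_neg]
      exact eq_inv_of_mul_eq_one_left hg)
    have hk1 : k = 1 := by
      rw [← ofAdd_toAdd k, ← neg_neg k.toAdd, hk0]
      rfl
    rw [hk1, toAdd_one, zpow_zero, mul_one, map_eq_one_iff j h.injective] at hg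
    rw [← SemidirectProduct.inl_left_mul_inr_right g, ← hk, hg, hk1]
    simp
  · obtain ⟨x, k, rfl⟩ := h.exists_eq g
    exact ⟨_, hf (.ofAdd x) (.ofAdd k)⟩

end Ideal

/-! ### From the axioms to an ideal -/

/-- Evaluation at T kills every multiple of p, hence every relation of r, so it factors through R.
The commutation clause makes the action of the complement R-linear. -/
theorem exists_ringHom_end {R M : Type*} [CommRing R] [AddCommGroup M] (r : R)
    (hsurj : Function.Surjective (aeval r : ℤ[X] →ₐ[ℤ] R)) {p : ℤ[X]}
    (hker : ∀ q : ℤ[X], aeval r q = 0 → p ∣ q) {T : Module.End ℤ M} (hT : aeval T p = 0) :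
    ∃ f : R →+* Module.End ℤ M, f r = T ∧ ∀ S, Commute S T → ∀ s, Commute S (f s) := by
  let f : R →+* Module.End ℤ M :=
    RingHom.liftOfSurjective (aeval r : ℤ[X] →ₐ[ℤ] R).toRingHom hsurj
      ⟨(aeval T : ℤ[X] →ₐ[ℤ] Module.End ℤ M).toRingHom, fun q hq => by
        obtain ⟨s, rfl⟩ := hker q hq
        change aeval T (p * s) = 0
        rw [map_mul, hT, zero_mul]⟩
  have hf : ∀ q : ℤ[X], f (aeval r q) = aeval T q := fun q =>
    RingHom.liftOfRightInverse_comp_apply _ _ _ _ q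
  refine ⟨f, by simpa using hf X, fun S hS s => ?_⟩
  obtain ⟨q, rfl⟩ := hsurj s
  rw [hf]
  induction q using Polynomial.induction_on' with
  | add q₁ q₂ h₁ h₂ => rw [map_add]; exact h₁.add_right h₂
  | monomial n k =>
    rw [aeval_monomial]
    exact (show Commute S _ from (Algebra.commutes k S).symm).mul_right (hS.pow_right n)

section ConjugationModule

open scoped IsMulCommutative

/-- Conjugation, as an action on the additive group of a commutative normal subgroup. -/
def conjEnd {G : Type*} [Group G] (A : Subgroup G) [A.Normal] [IsMulCommutative A] :
    G →* Module.End ℤ (Additive A) where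
  toFun g := (MonoidHom.toAdditive (MulAut.conjNormal g : A ≃* A).toMonoidHom).toIntLinearMap
  map_one' := by ext; simp
  map_mul' g h := by ext; simp [mul_assoc]

theorem coe_conjEnd {G : Type*} [Group G] (A : Subgroup G) [A.Normal] [IsMulCommutative A] (g : G)
    (x : Additive A) : ((conjEnd A g x).toMul : G) = g * x.toMul * g⁻¹ := rfl

/-- The inclusion of a commutative subgroup, with its elements written additively. -/
def additiveSubtype {G : Type*} [Group G] (A : Subgroup G) : Multiplicative (Additive A) →* G where
  toFun x := x.toAdd.toMul
  map_one' := rfl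
  map_mul' _ _ := rfl

theorem exists_isSplit_of_splitAxioms {R : Type*} [CommRing R] [IsDomain R] [CharZero R]
    [IsIntegrallyClosed R] [Module.Free ℤ R] [Module.Finite ℤ R] {v : Rˣ}
    (hv : ∀ k : ℤ, v ^ k = 1 → k = 0) (hunits : ∀ w : Rˣ, ∃ k : ℤ, w = v ^ k ∨ w = -v ^ k)
    (hsurj : Function.Surjective (aeval (v : R) : ℤ[X] →ₐ[ℤ] R)) {p : ℤ[X]}
    (hker : ∀ q : ℤ[X], aeval (v : R) q = 0 → p ∣ q) {G : Type*} [Group G] [Group.FG G] {a t : G}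
    (h : SplitAxioms p (2 ^ Module.finrank ℤ R) a t) :
    ∃ I : Ideal R, I ≠ ⊥ ∧ ∃ j : Multiplicative I →* G, IsSplit v j t := by
  let A : Subgroup G := Subgroup.centralizer {a}
  let C : Subgroup G := Subgroup.centralizer {t}
  have hA : ∀ {g}, g ∈ A ↔ Commute g a := Subgroup.mem_centralizer_singleton_iff
  have hC : ∀ {g}, g ∈ C ↔ Commute g t := Subgroup.mem_centralizer_singleton_iff
  have : A.Normal := ⟨fun x hx g => hA.2 (h.normal x (hA.1 hx) g)⟩
  have : IsMulCommutative A :=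
    ⟨⟨fun x y => Subtype.ext (h.comm x (hA.1 x.2) y (hA.1 y.2))⟩⟩
  have : IsMulCommutative C :=
    ⟨⟨fun x y => Subtype.ext (h.comm' x (hC.1 x.2) y (hC.1 y.2))⟩⟩
  have hT : aeval (conjEnd A t) p = 0 := by
    refine LinearMap.ext fun x => ?_
    have h1 := polyConj_map_ofAdd (additiveSubtype A) (t := t) (T := conjEnd A t)
      (fun _ => rfl) p x
    exact Additive.toMul.injective (Subtype.ext
      (h1.symm.trans (h.polyConj_eq_one _ (hA.1 x.toMul.2))))
  obtain ⟨f, hfv, hf⟩ := exists_ringHom_end (v : R) hsurj hker hT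
  let _ : Module R (Additive A) := Module.compHom _ f
  have hsmul : ∀ (r : R) (x : Additive A), r • x = f r x := fun _ _ => rfl
  let ρ : C →* Module.End R (Additive A) :=
    { toFun := fun c =>
        { toFun := conjEnd A c
          map_add' := map_add _
          map_smul' := fun r x => by
            have h1 : Commute (conjEnd A c) (conjEnd A t) := (hC.1 c.2).map (conjEnd A)
            exact LinearMap.congr_fun (hf _ h1 r).eq x }
      map_one' := LinearMap.ext fun x => LinearMap.congr_fun (map_one (conjEnd A)) x
      map_mul' := fun c d => LinearMap.ext fun x =>
        LinearMap.congr_fun (map_mul (conjEnd A) (c : G) d) x }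
  have hρ : ∀ c x, ((ρ c x).toMul : G) = c * x.toMul * (c : G)⁻¹ := fun _ _ => rfl
  let t' : C := ⟨t, hC.2 (Commute.refl t)⟩
  have ht : ∀ x, ρ t' x = v • x := fun x => by
    rw [Units.smul_def, hsmul, hfv]
    rfl
  choose x c hx hc hxc using h.exists_mul
  obtain ⟨S, hS, hSfin⟩ := Group.fg_iff.1 (inferInstance : Group.FG G)
  -- The C-components of generators of G generate C: together with A they generate G, and A ∩ C is
  -- trivial.
  have hCfg : Group.FG C := by
    refine (Group.fg_iff_subgroup_fg C).2 ((Subgroup.fg_iff C).2 ⟨c '' S, le_antisymm ?_ fun g hg => ?_, hSfin.image c⟩)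
    · rw [Subgroup.closure_le]
      rintro _ ⟨s, -, rfl⟩
      exact hC.2 (hc s)
    · have htop : A ⊔ Subgroup.closure (c '' S) = ⊤ := by
        rw [eq_top_iff, ← hS, Subgroup.closure_le]
        intro s hs
        rw [hxc s]
        exact Subgroup.mul_mem_sup (hA.2 (hx s)) (Subgroup.subset_closure ⟨s, hs, rfl⟩)
      obtain ⟨y, hy, z, hz, rfl⟩ := Subgroup.mem_sup_of_normal_left.1
        (htop ▸ Subgroup.mem_top g : g ∈ A ⊔ Subgroup.closure (c '' S))
      have hzC : z ∈ C := by
        refine (Subgroup.closure_le C).2 ?_ hz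
        rintro _ ⟨s, -, rfl⟩
        exact hC.2 (hc s)
      rwa [h.disjoint y (hA.1 hy) (hC.1 ((Subgroup.mul_mem_cancel_right C hzC).1 hg)), one_mul]
  have hgen : ∀ L : Submodule R (Additive A),
      (fun s => Additive.ofMul (⟨x s, hA.2 (hx s)⟩ : A)) '' S ⊆ L →
      (∀ c, ∀ x ∈ L, ρ c x ∈ L) → L = ⊤ := by
    intro L hSL hL
    -- For a C-stable L, the product L·C is a subgroup containing the generators of G. As A ∩ C = 1,
    -- its intersection with A is L, so L is everything.
    let K : Subgroup G :=
      { carrier := {g | ∃ x ∈ L, ∃ c : C, g = x.toMul * c}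
        one_mem' := ⟨0, L.zero_mem, 1, by simp⟩
        mul_mem' := by
          rintro _ _ ⟨x, hx, c, rfl⟩ ⟨y, hy, d, rfl⟩
          refine ⟨x + ρ c y, L.add_mem hx (hL c y hy), c * d, ?_⟩
          rw [toMul_add, Subgroup.coe_mul, hρ, Subgroup.coe_mul]
          group
        inv_mem' := by
          rintro _ ⟨x, hx, c, rfl⟩
          refine ⟨-ρ c⁻¹ x, L.neg_mem (hL _ x hx), c⁻¹, ?_⟩
          rw [toMul_neg, Subgroup.coe_inv, hρ, Subgroup.coe_inv]
          group }
    have hK : K = ⊤ := by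
      rw [eq_top_iff, ← hS, Subgroup.closure_le]
      exact fun s hs => ⟨_, hSL ⟨s, hs, rfl⟩, ⟨c s, hC.2 (hc s)⟩, hxc s⟩
    rw [eq_top_iff]
    rintro y -
    obtain ⟨z, hz, d, hd⟩ : (y.toMul : G) ∈ K := hK ▸ Subgroup.mem_top _
    have hd1 : (d : G) = 1 := by
      refine h.disjoint d (hA.1 ?_) (hC.1 d.2)
      exact (Subgroup.mul_mem_cancel_left A z.toMul.2).1 (hd ▸ y.toMul.2)
    rw [hd1, mul_one] at hd
    have : y = z := Additive.toMul.injective (Subtype.ext hd)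
    exact this ▸ hz
  obtain ⟨y, hyA, hy⟩ := h.index_le
  let a' : Additive A := .ofMul ⟨a, hA.2 (Commute.refl a)⟩
  obtain ⟨htop, htord, φ, hφ, hφa⟩ := zpowers_eq_top_and_exists_injective ρ v (t := t') hv hunits ht
    (fun c x hcx hx => by
      by_contra hc
      have hcom : Commute (c : G) x.toMul := by
        have := congrArg (fun y : Additive A => (y.toMul : G)) hcx
        exact mul_inv_eq_iff_eq_mul.1 this
      refine hc (Subtype.ext (h.disjoint c ?_ (hC.1 c.2)))
      exact h.commute_of_commute _ (hA.1 x.toMul.2)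
        (fun hx1 => hx (Additive.toMul.injective (Subtype.ext hx1))) c hcom)
    (fun c => by
      obtain ⟨d, hd, hcd⟩ := h.exists_sq c (hC.1 c.2)
      exact ⟨⟨d, hC.2 hd⟩, hcd.imp Subtype.ext Subtype.ext⟩)
    (fun x hx => Additive.toMul.injective (Subtype.ext
      (h.eq_one_of_sq _ (hA.1 x.toMul.2) (congrArg (fun y : Additive A => (y.toMul : G)) hx))))
    (a := a')
    (fun z hz => h.not_sq _ (hA.1 z.toMul.2) (congrArg (fun y : Additive A => (y.toMul : G)) hz))
    (fun i => .ofMul ⟨y i, hA.2 (hyA i)⟩)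
    (fun x => by
      obtain ⟨z, hz, i, hi⟩ := hy _ (hA.1 x.toMul.2)
      exact ⟨.ofMul ⟨z, hA.2 hz⟩, i, Additive.toMul.injective (Subtype.ext hi)⟩)
    (hSfin.image _) hgen
  -- The ideal is the image of A in R, non-zero because it contains the non-zero φ(a).
  refine ⟨φ.range, fun h0 => hφa ?_, _, IsSplit.mulEquiv (j := additiveSubtype A) ?_
    (LinearEquiv.ofInjective φ hφ).symm⟩
  · rw [← Submodule.mem_bot R, ← h0]
    exact LinearMap.mem_range_self φ a'
  · refine ⟨fun y z hyz => ?_, fun y => ?_, fun g => ?_, fun y k hk => ?_⟩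
    · exact Multiplicative.toAdd.injective (Additive.toMul.injective (Subtype.ext hyz))
    · rw [← ht]
      rfl
    · obtain ⟨k, hk⟩ : (⟨c g, hC.2 (hc g)⟩ : C) ∈ Subgroup.zpowers t' := htop ▸ Subgroup.mem_top _
      refine ⟨.ofMul ⟨x g, hA.2 (hx g)⟩, k, (hxc g).trans ?_⟩
      exact congrArg (x g * ·) (congrArg Subtype.val hk).symm
    · have h1 : t ^ k = 1 := by
        refine h.disjoint _ (hA.1 ?_) ((Commute.refl t).zpow_left k)
        rw [← hk]
        exact y.toMul.2
      exact htord k (Subtype.ext h1)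

end ConjugationModule

/-! ### Arithmetic of ℤ[u] and conclusion -/

section IntAdjoin

variable {u : ℂ}

theorem isIntegral_of_intAdjoin_eq (hclosed : (IntAdjoin u : Set ℂ) =
    Subtype.val '' (integralClosure ℤ (RatAdjoin u) : Set (RatAdjoin u))) : IsIntegral ℤ u := by
  have hu : u ∈ (IntAdjoin u : Set ℂ) := Algebra.self_mem_adjoin_singleton ℤ u
  rw [hclosed] at hu
  obtain ⟨x, hx, hxu⟩ := hu
  exact hxu ▸ IsIntegral.map ((RatAdjoin u).val.restrictScalars ℤ) hx

/-- Embed the fraction field in ℂ. Its image lies in ℚ[u], which contains the inverses of its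
algebraic elements. An element integral over ℤ[u] is integral over ℤ, and so lies in ℤ[u] by
hypothesis. -/
theorem isIntegrallyClosed_intAdjoin (hclosed : (IntAdjoin u : Set ℂ) =
    Subtype.val '' (integralClosure ℤ (RatAdjoin u) : Set (RatAdjoin u))) :
    IsIntegrallyClosed (IntAdjoin u) := by
  have hu := isIntegral_of_intAdjoin_eq hclosed
  have hint : Algebra.IsIntegral ℤ (IntAdjoin u) := Algebra.IsIntegral.adjoin (by simpa using hu)
  have hle : ∀ x : IntAdjoin u, (x : ℂ) ∈ RatAdjoin u := fun x => by
    have : IntAdjoin u ≤ (RatAdjoin u).restrictScalars ℤ :=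
      Algebra.adjoin_le (Set.singleton_subset_iff.2 (Algebra.self_mem_adjoin_singleton ℚ u))
    exact this x.2
  let K := FractionRing (IntAdjoin u)
  let i : K →ₐ[IntAdjoin u] ℂ :=
    IsFractionRing.liftAlgHom (g := Algebra.ofId (IntAdjoin u) ℂ) Subtype.val_injective
  rw [isIntegrallyClosed_iff K]
  intro x hx
  have hxi : IsIntegral ℤ (i x) := isIntegral_trans (R := ℤ) _ (hx.map i)
  have hmem : i x ∈ RatAdjoin u := by
    obtain ⟨b, a, ha, rfl⟩ := IsFractionRing.div_surjective (A := IntAdjoin u) x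
    rw [map_div₀, AlgHom.commutes, AlgHom.commutes, div_eq_mul_inv]
    refine mul_mem (hle b) (Subalgebra.inv_mem_of_algebraic (RatAdjoin u) (x := ⟨a, hle a⟩) ?_)
    have ha : IsIntegral ℤ (a : ℂ) := (hint.1 a).map (IntAdjoin u).val
    exact (ha.tower_top (A := ℚ)).isAlgebraic
  have : i x ∈ (IntAdjoin u : Set ℂ) := by
    rw [hclosed]
    refine ⟨⟨i x, hmem⟩, ?_, rfl⟩
    exact (isIntegral_algHom_iff ((RatAdjoin u).val.restrictScalars ℤ)
      Subtype.val_injective).1 hxi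
  exact ⟨⟨i x, this⟩, i.injective (AlgHom.commutes i _)⟩

end IntAdjoin

theorem exists_eq_zpow_or_neg {R : Type*} [CommRing R] {v : Rˣ}
    (hgen : Subgroup.closure ({v, -1} : Set Rˣ) = ⊤) (w : Rˣ) :
    ∃ k : ℤ, w = v ^ k ∨ w = -v ^ k := by
  have hw : w ∈ Subgroup.closure ({v, -1} : Set Rˣ) := hgen ▸ Subgroup.mem_top w
  rw [Subgroup.mem_closure_pair] at hw
  obtain ⟨k, l, rfl⟩ := hw
  refine ⟨k, ?_⟩
  rcases Int.even_or_odd l with hl | hl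
  · exact .inl (by rw [hl.neg_one_zpow, mul_one])
  · exact .inr (by rw [hl.neg_one_zpow, mul_neg, mul_one])

/-- If `v` had finite order, the unit group ±⟨v⟩ would be finite. -/
theorem eq_zero_of_zpow_eq_one {R : Type*} [CommRing R] [Infinite Rˣ] {v : Rˣ}
    (hunits : ∀ w : Rˣ, ∃ k : ℤ, w = v ^ k ∨ w = -v ^ k) (k : ℤ) (hk : v ^ k = 1) : k = 0 := by
  by_contra hk0
  have : Finite (Subgroup.zpowers v) :=
    (isOfFinOrder_iff_zpow_eq_one.2 ⟨k, hk0, hk⟩).finite_zpowers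
  refine not_finite_iff_infinite.2 (inferInstance : Infinite Rˣ) ?_
  refine Finite.of_surjective
    (Sum.elim (fun w : Subgroup.zpowers v => (w : Rˣ)) fun w : Subgroup.zpowers v => -(w : Rˣ))
    fun w => ?_
  obtain ⟨l, rfl | rfl⟩ := hunits w
  · exact ⟨.inl ⟨v ^ l, l, rfl⟩, rfl⟩
  · exact ⟨.inr ⟨v ^ l, l, rfl⟩, rfl⟩

/-- A non-zero finitely generated free additive group has an element which is not a double. -/
theorem exists_forall_ne_add_self (M : Type*) [AddCommGroup M] [Module.Free ℤ M]
    [Module.Finite ℤ M] [Nontrivial M] : ∃ a : M, ∀ z, a ≠ z + z := by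
  by_contra! h
  -- If all elements are doubles, 0 alone represents M/2M, so the rank is 0.
  have hle := finrank_le_of_forall_exists_add (n := 0) (fun _ => (0 : M)) fun x => by
    obtain ⟨z, hz⟩ := h x
    exact ⟨z, 0, by rw [zero_add, hz]⟩
  exact (Module.finrank_pos (R := ℤ) (M := M)).ne' (Nat.le_zero.1 hle)

theorem mainTheorem7 (u : ℂ)
    (hclosed : (IntAdjoin u : Set ℂ) =
      Subtype.val '' (integralClosure ℤ (RatAdjoin u) : Set (RatAdjoin u)))
    (hinf : Infinite (IntAdjoin u)ˣ)
    (v : (IntAdjoin u)ˣ) (hv : ((v : IntAdjoin u) : ℂ) = u)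
    (hgen : Subgroup.closure ({v, -1} : Set (IntAdjoin u)ˣ) = ⊤) :
    ∃ ψ : groupLanguage.Sentence, ∀ (G : Type*) [Group G],
      (Group.FG G ∧ FirstOrder.Language.Sentence.Realize G ψ) ↔
        ∃ A : Ideal (IntAdjoin u), A ≠ ⊥ ∧ Nonempty (G ≃* IdealSemidirect A v) := by
  have hu := isIntegral_of_intAdjoin_eq hclosed
  have := isIntegrallyClosed_intAdjoin hclosed
  have : Module.Finite ℤ (IntAdjoin u) := Module.Finite.iff_fg.2 hu.fg_adjoin_singleton
  have : Module.Free ℤ (IntAdjoin u) := Module.free_of_finite_type_torsion_free'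
  have hunits := exists_eq_zpow_or_neg hgen
  have hv0 := eq_zero_of_zpow_eq_one hunits
  have hval : ∀ q : ℤ[X], ((aeval (v : IntAdjoin u) q : IntAdjoin u) : ℂ) = aeval u q := by
    intro q
    exact (aeval_algHom_apply (IntAdjoin u).val _ q).symm.trans (congrArg (aeval · q) hv)
  have hsurj : Function.Surjective (aeval (v : IntAdjoin u) : ℤ[X] →ₐ[ℤ] IntAdjoin u) := by
    rintro ⟨x, hx⟩
    have hx' := hx
    rw [IntAdjoin, Algebra.adjoin_singleton_eq_range_aeval] at hx'
    obtain ⟨q, rfl⟩ := hx'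
    exact ⟨q, Subtype.ext (hval q)⟩
  obtain ⟨ψ, hψ⟩ := exists_sentence_splitAxioms (minpoly ℤ u)
    (2 ^ Module.finrank ℤ (IntAdjoin u))
  refine ⟨ψ, fun G _ => ⟨fun ⟨hG, hGψ⟩ => ?_, fun ⟨A, hA, ⟨e⟩⟩ => ?_⟩⟩
  · obtain ⟨a, t, h⟩ := (hψ G).1 hGψ
    obtain ⟨I, hI, j, hj⟩ := exists_isSplit_of_splitAxioms hv0 hunits hsurj (fun q hq =>
      minpoly.isIntegrallyClosed_dvd hu (by rw [← hval, hq]; rfl)) h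
    exact ⟨I, hI, hj.nonempty_mulEquiv hv0⟩
  · have hs := isSplit_of_mulEquiv hv0 e
    have : Module.Finite ℤ A :=
      inferInstanceAs (Module.Finite ℤ (A.restrictScalars ℤ))
    have : Module.Free ℤ A := Module.free_of_finite_type_torsion_free'
    have : Nontrivial A := Submodule.nontrivial_iff_ne_bot.2 hA
    obtain ⟨a, ha⟩ := exists_forall_ne_add_self A
    -- A non-zero ideal has the rank of the ring, so one constant in the sentence serves every A.
    have hrank : Module.finrank ℤ A = Module.finrank ℤ (IntAdjoin u) :=
      Ideal.finrank_eq_finrank (Module.Free.chooseBasis ℤ (IntAdjoin u)) A hA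
    refine ⟨hs.fg, (hψ G).2 ⟨_, _, hrank ▸ hs.splitAxioms hv0 (Subtype.ext ?_) ha⟩⟩
    rw [hval, minpoly.aeval]
    rfl
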